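/- All groups are finite. A chief factor of a group $G$ is a quotient $A/B$, where $B<A$ are normal subgroups of $G$ with no normal subgroup of $G$ strictly between them; $C_G(A/B)$ is the kernel of the conjugation action of $G$ on $A/B$. For an isomorphism-closed class $\mathfrak F$ of groups, $G$ is a $ca$-$\mathfrak F$-group if every non-abelian chief factor of $G$ is simple and, for every abelian chief factor $A/B$ of $G$, the semidirect product $(A/B)\rtimes (G/C_G(A/B))$, formed with the conjugation action, belongs to $\mathfrak F$. A formation is an isomorphism-closed class $\mathfrak F$ of groups, closed under quotients, such that every group $X$ has a smallest normal subgroup with quotient in $\mathfrak F$; it is saturated if $X/\Phi(X)\in\mathfrak F$ implies $X\in\mathfrak F$ for every group $X$, where $\Phi(X)$ is the Frattini subgroup. A group is quasinilpotent if each of its elements induces an inner automorphism on each of its chief factors. A group is supersoluble if it has a finite series of normal subgroups (normal in the whole group) from $1$ to the group with cyclic factors. Let $\mathfrak F$ be a saturated formation containing the class $\mathfrak U$ of all supersoluble groups. If $G=HK$ is the product of normal subgroups $H$ and $K$ of $G$ that are $ca$-$\mathfrak F$-groups, and the derived subgroup $G'$ of $G$ is quasinilpotent, then $G$ is a $ca$-$\mathfrak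 F$-group. -/

import Mathlib

open scoped Pointwise

universe u

/-- A class of groups, given by its membership predicate. Only its values on finite groups
are ever used. -/
abbrev GroupClass : Type (u + 1) := ∀ (G : Type u) [Group G], Prop

/-- A formation of finite groups: an isomorphism-closed class, closed under quotients, such that
every finite group has a smallest normal subgroup with quotient in the class. -/
structure IsFormation (F : GroupClass.{u}) : Prop where
  iso : ∀ (X Y : Type u) [Group X] [Group Y] [Finite X] [Finite Y], (X ≃* Y) → F X → F Y
  quotient : ∀ (X : Type u) [Group X] [Finite X] (N : Subgroup X) [N.Normal], F X → F (X ⧸ N)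
  residual : ∀ (X : Type u) [Group X] [Finite X],
    ∃ (R : Subgroup X) (_ : R.Normal), F (X ⧸ R) ∧
      ∀ (N : Subgroup X) [N.Normal], F (X ⧸ N) → R ≤ N

/-- A saturated formation: a formation containing each finite group `X` such that `X / Φ(X)` belongs
to it. -/
structure IsSaturatedFormation (F : GroupClass.{u}) : Prop extends IsFormation F where
  saturated : ∀ (X : Type u) [Group X] [Finite X], F (X ⧸ frattini X) → F X

section Factors

variable {G : Type u} [Group G]

/-- `H / K` is a chief factor of `G`. -/
structure IsChiefFactor (H K : Subgroup G) : Prop where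
  normal_top : H.Normal
  normal_bot : K.Normal
  lt : K < H
  eq_or_eq : ∀ L : Subgroup G, L.Normal → K ≤ L → L ≤ H → L = K ∨ L = H

/-- The factor `H / K`. -/
abbrev NormalFactor (H K : Subgroup G) : Type u := H ⧸ K.subgroupOf H

/-- The conjugation action of `G` on the factor `H / K` of normal subgroups. -/
def factorConj (H K : Subgroup G) [H.Normal] [K.Normal] : G →* MulAut (NormalFactor H K) where
  toFun g := QuotientGroup.congr (K.subgroupOf H) (K.subgroupOf H) (MulAut.conjNormal g) (by
    ext x
    refine (Subgroup.mem_map_equiv (f := (MulAut.conjNormal g : H ≃* H))).trans ?_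
    rw [Subgroup.mem_subgroupOf, Subgroup.mem_subgroupOf, MulAut.conjNormal_symm_apply]
    have hK : K.Normal := inferInstance
    constructor
    · intro h
      have := hK.conj_mem _ h g
      simpa [mul_assoc] using this
    · intro h
      have := hK.conj_mem _ h g⁻¹
      simpa [mul_assoc] using this)
  map_one' := by
    ext x
    induction x using QuotientGroup.induction_on with
    | H x => simp [QuotientGroup.congr_mk]
  map_mul' a b := by
    ext x
    induction x using QuotientGroup.induction_on with
    | H x => simp [QuotientGroup.congr_mk]

/-- The centralizer `C_G(H / K)`: the elements of `G` acting trivially on `H / K`. -/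
def factorCentralizer (H K : Subgroup G) [H.Normal] [K.Normal] : Subgroup G :=
  (factorConj H K).ker

instance factorCentralizer_normal (H K : Subgroup G) [H.Normal] [K.Normal] :
    (factorCentralizer H K).Normal :=
  MonoidHom.normal_ker _

/-- The faithful action of `G / C_G(H / K)` on `H / K` induced by conjugation. -/
def factorAction (H K : Subgroup G) [H.Normal] [K.Normal] :
    G ⧸ factorCentralizer H K →* MulAut (NormalFactor H K) :=
  QuotientGroup.kerLift (factorConj H K)

/-- `H / K` is `F`-central in `G`: the semidirect product of `H / K` with `G / C_G(H / K)` belongs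
to `F`. -/
def IsFCentral (F : GroupClass.{u}) (H K : Subgroup G) [H.Normal] [K.Normal] : Prop :=
  F (NormalFactor H K ⋊[factorAction H K] (G ⧸ factorCentralizer H K))

/-- The factor `H / K` is an abelian group. -/
def IsAbelianFactor (H K : Subgroup G) [K.Normal] : Prop :=
  ∀ x y : NormalFactor H K, x * y = y * x

end Factors

/-- `G` is a `ca`-`F`-group: every non-abelian chief factor of `G` is simple and every abelian chief
factor of `G` is `F`-central. -/
structure IsCaGroup (F : GroupClass.{u}) (G : Type u) [Group G] : Prop where
  simple : ∀ (H K : Subgroup G) [H.Normal] [K.Normal], IsChiefFactor H K →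
    ¬ IsAbelianFactor H K → IsSimpleGroup (NormalFactor H K)
  central : ∀ (H K : Subgroup G) [H.Normal] [K.Normal], IsChiefFactor H K →
    IsAbelianFactor H K → IsFCentral F H K

/-- `G` is supersoluble: it has a finite series of normal subgroups of `G` with cyclic factors. -/
def IsSupersoluble (G : Type u) [Group G] : Prop :=
  ∃ (n : ℕ) (S : ℕ → Subgroup G) (_ : ∀ i, (S i).Normal), S 0 = ⊥ ∧ S n = ⊤ ∧
    ∀ i < n, S i ≤ S (i + 1) ∧ IsCyclic (NormalFactor (S (i + 1)) (S i))

/-- `G` is quasinilpotent: every element of `G` induces an inner automorphism on every chief factor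
of `G`. -/
def IsQuasinilpotent (G : Type u) [Group G] : Prop :=
  ∀ (H K : Subgroup G) [H.Normal] [K.Normal], IsChiefFactor H K →
    ∀ g : G, ∃ x : NormalFactor H K, factorConj H K g = MulAut.conj x

/-! ### Closure properties of formations. -/

section Formations

variable {F : GroupClass.{u}}

namespace IsFormation

/-! Let `A / B` be a chief factor of `G = HK`. A normal subgroup acting nontrivially on it has a
chief factor of its own embedded equivariantly in `A / B` as a normal subgroup
(`IsChiefFactor.exists_embedding`).

Non-abelian case: the embedded factors are simple and non-abelian. If `H` and `K` both act
nontrivially, some `G`-translate of the `K`-invariant one does not commute with the `H`-invariant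
one. Two such simple normal subgroups coincide, so the result is invariant under `HK` and fills `A /
B` by irreducibility. If one of `H`, `K` acts trivially, the other alone suffices.

Abelian case: `G'` acts trivially, because quasinilpotence makes it act trivially on an embedded
abelian factor. So `G` acts as an abelian group, and an element fixing one nontrivial point acts
trivially. Hence the groups `D₁`, `D₂` that `H` and `K` induce have regular orbits on `p`-groups
`V₁`, `V₂` with `Vᵢ ⋊ Dᵢ` in `F`. For `D = D₁ × D₂` and `V = V₁ × V₂`, saturation puts the wreath
product of `N = A / B` by `V ⋊ D`, acting affinely on `V`, into `F`
(`IsSaturatedFormation.wreathProduct`). The regular orbit exhibits `N ⋊ D` as a quotient of a split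
extension built from it (`HasRegularExtension.semidirectProduct`). Finally `D` maps onto `G / C_G(A
/ B)`. -/

theorem of_surjective (hF : IsFormation F)
    {X Y : Type u} [Group X] [Group Y] [Finite X] [Finite Y] (f : X →* Y)
    (hf : Function.Surjective f) (hX : F X) : F Y :=
  hF.iso _ _ (QuotientGroup.quotientKerEquivOfSurjective f hf) (hF.quotient X f.ker hX)

/-- A formation is closed under subdirect products. -/
theorem of_ker_inf_ker_eq_bot (hF : IsFormation F)
    {Z X Y : Type u} [Group Z] [Group X] [Group Y] [Finite Z] [Finite X]
    [Finite Y] (f : Z →* X) (g : Z →* Y) (hf : Function.Surjective f)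
    (hg : Function.Surjective g) (hfg : f.ker ⊓ g.ker = ⊥) (hX : F X) (hY : F Y) : F Z := by
  obtain ⟨R, hR, hFR, hmin⟩ := hF.residual Z
  have h1 : R ≤ f.ker :=
    hmin _ (hF.iso _ _ (QuotientGroup.quotientKerEquivOfSurjective f hf).symm hX)
  have h2 : R ≤ g.ker :=
    hmin _ (hF.iso _ _ (QuotientGroup.quotientKerEquivOfSurjective g hg).symm hY)
  have h3 : R = ⊥ := le_bot_iff.mp (hfg ▸ le_inf h1 h2)
  subst h3
  exact hF.iso _ _ QuotientGroup.quotientBot hFR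

theorem prod (hF : IsFormation F)
    {X Y : Type u} [Group X] [Group Y] [Finite X] [Finite Y] (hX : F X) (hY : F Y) :
    F (X × Y) := by
  refine hF.of_ker_inf_ker_eq_bot (MonoidHom.fst X Y) (MonoidHom.snd X Y) Prod.fst_surjective
    Prod.snd_surjective ?_ hX hY
  rw [eq_bot_iff]
  rintro ⟨x, y⟩ ⟨h1, h2⟩
  have h1' : x = 1 := h1
  have h2' : y = 1 := h2
  simp [h1', h2']

/-- If `X` lies in a formation, so does the split extension of a normal subgroup of `X`
by `X`. -/
theorem semidirectProduct_conjNormal (hF : IsFormation F)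
    {X : Type u} [Group X] [Finite X] (hX : F X) (B : Subgroup X)
    [B.Normal] :
    F (B ⋊[(MulAut.conjNormal : X →* MulAut B)] X) := by
  have : Finite (B ⋊[(MulAut.conjNormal : X →* MulAut B)] X) :=
    Finite.of_equiv _ SemidirectProduct.equivProd.symm
  -- The maps `(b, x) ↦ x` and `(b, x) ↦ b * x` are both onto `X`, and their kernels meet trivially.
  refine hF.of_ker_inf_ker_eq_bot (SemidirectProduct.rightHom)
    (SemidirectProduct.lift B.subtype (MonoidHom.id X) ?_)
    SemidirectProduct.rightHom_surjective (fun x => ⟨SemidirectProduct.inr x, ?_⟩) ?_ hX hX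
  · intro g
    ext b
    simp [MulAut.conjNormal_apply]
  · simp
  · rw [eq_bot_iff]
    rintro ⟨b, x⟩ ⟨h1, h2⟩
    have h1' : x = 1 := h1
    subst h1'
    have h2' : (b : X) * 1 = 1 := h2
    rw [mul_one] at h2'
    have : b = 1 := Subtype.ext h2'
    subst this
    exact Subgroup.mem_bot.mpr rfl

/-- A formation containing all finite cyclic groups contains all finite abelian groups. -/
theorem of_commGroup (hF : IsFormation F)
    (hcyc : ∀ (X : Type u) [Group X] [Finite X], IsCyclic X → F X)
    (X : Type u) [CommGroup X] [Finite X] : F X := by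
  obtain ⟨R, hR, hFR, hmin⟩ := hF.residual X
  have hR' : R = ⊥ := by
    rw [eq_bot_iff]
    intro r hr
    by_contra hr1
    have : NeZero (Monoid.exponent X) := ⟨Monoid.exponent_ne_zero_of_finite⟩
    -- Complex characters separate points, and each has finite image in `ℂˣ`, hence cyclic: the
    -- residual lies in every such kernel.
    obtain ⟨χ, hχ⟩ := CommGroup.exists_apply_ne_one_of_hasEnoughRootsOfUnity X ℂ
      (a := r) (by simpa using hr1)
    refine hχ (hmin χ.ker (hcyc _ ?_) hr)
    refine isCyclic_of_injective_ringHom ((Units.coeHom ℂ).comp (QuotientGroup.kerLift χ)) ?_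
    exact Units.val_injective.comp (QuotientGroup.kerLift_injective χ)
  subst hR'
  exact hF.iso _ _ QuotientGroup.quotientBot hFR

end IsFormation

theorem isSupersoluble_of_isCyclic (X : Type u) [Group X] (hX : IsCyclic X) :
    IsSupersoluble X := by
  refine ⟨1, fun i => if i = 0 then ⊥ else ⊤, fun i => ?_, by simp, by simp, fun i hi => ?_⟩
  · dsimp only
    split_ifs <;> infer_instance
  · obtain rfl : i = 0 := by omega
    refine ⟨by simp, ?_⟩
    exact isCyclic_of_surjective (QuotientGroup.mk' _) (QuotientGroup.mk'_surjective _)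

end Formations

/-! ### Nilpotent normal subgroups and existence of chief factors. -/

section Nilpotent

variable {X : Type u} [Group X]

/-- A nilpotent normal subgroup centralizes each chief factor below it. -/
theorem IsChiefFactor.commutator_le_of_isNilpotent {C B P : Subgroup X} [P.Normal]
    (hP : Group.IsNilpotent P) (h : IsChiefFactor C B) (hCP : C ≤ P) : ⁅C, P⁆ ≤ B := by
  have := h.normal_top
  have := h.normal_bot
  have hle : ⁅C, P⁆ ≤ C := Subgroup.commutator_le_left _ _
  rcases h.eq_or_eq (⁅C, P⁆ ⊔ B) inferInstance le_sup_right (sup_le hle h.lt.le) with h1 | h1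
  · exact le_sup_left.trans h1.le
  · exfalso
    let q := QuotientGroup.mk' B
    -- Modulo `B`, `C` would equal its commutator with `P`, so it would lie in every term of the
    -- lower central series.
    have hq : C.map q = ⁅C.map q, P.map q⁆ := by
      conv_lhs => rw [← h1]
      rw [Subgroup.map_sup, Subgroup.map_commutator,
        (Subgroup.map_eq_bot_iff (f := q) B).mpr (QuotientGroup.ker_mk' B).ge, sup_bot_eq]
    have key : ∀ n, C.map q ≤ (P.map q).lowerCentralSeries n := by
      intro n
      induction n with
      | zero => exact Subgroup.map_mono hCP
      | succ n ih =>
        rw [hq, Subgroup.lowerCentralSeries_succ]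
        exact Subgroup.commutator_mono ih le_rfl
    obtain ⟨n, hn⟩ := (Subgroup.isNilpotent_iff_lowerCentralSeries P).mp hP
    have := key n
    rw [← Subgroup.map_lowerCentralSeries, hn, Subgroup.map_bot, le_bot_iff,
      Subgroup.map_eq_bot_iff, QuotientGroup.ker_mk'] at this
    exact h.lt.not_ge this

/-- Below a nontrivial normal factor there is a chief factor. -/
theorem exists_isChiefFactor_of_lt [Finite X] {A B : Subgroup X} (hA : A.Normal) (hB : B.Normal)
    (h : B < A) : ∃ M : Subgroup X, M ≤ A ∧ IsChiefFactor M B := by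
  obtain ⟨M, ⟨hMn, hBM, hMA⟩, hmin⟩ := (Set.toFinite {M : Subgroup X | M.Normal ∧ B < M ∧ M ≤ A}
    ).exists_minimal ⟨A, hA, h, le_rfl⟩
  refine ⟨M, hMA, hMn, hB, hBM, fun L hL hBL hLM => ?_⟩
  rcases hBL.eq_or_lt with h1 | h1
  · exact Or.inl h1.symm
  · exact Or.inr (le_antisymm hLM (hmin ⟨hL, h1, hLM.trans hMA⟩ hLM))

/-- Dually, there is a chief factor on top. -/
theorem exists_isChiefFactor_of_lt' [Finite X] {A B : Subgroup X} (hA : A.Normal) (hB : B.Normal)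
    (h : B < A) : ∃ M : Subgroup X, B ≤ M ∧ IsChiefFactor A M := by
  obtain ⟨M, ⟨hMn, hBM, hMA⟩, hmax⟩ := (Set.toFinite {M : Subgroup X | M.Normal ∧ B ≤ M ∧ M < A}
    ).exists_maximal ⟨B, hB, le_rfl, h⟩
  refine ⟨M, hBM, hA, hMn, hMA, fun L hL hML hLA => ?_⟩
  rcases hLA.eq_or_lt with h1 | h1
  · exact Or.inr h1
  · exact Or.inl (le_antisymm (hmax ⟨hL, hBM.trans hML, h1⟩ hML) hML)

end Nilpotent

/-! ### Wreath products in a saturated formation. -/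

section Wreath

variable {F : GroupClass.{u}}

instance SemidirectProduct.instFinite {N G : Type*} [Group N] [Group G] [Finite N] [Finite G]
    (φ : G →* MulAut N) : Finite (N ⋊[φ] G) :=
  Finite.of_equiv _ SemidirectProduct.equivProd.symm

/-- A maximal subgroup not containing an abelian normal subgroup `A` meets it in a subgroup `B` with
`A / B` a chief factor. -/
theorem IsCoatom.isChiefFactor_inf {X : Type u} [Group X] {A M : Subgroup X} [A.Normal]
    (hM : IsCoatom M) (hA : ∀ x ∈ A, ∀ y ∈ A, x * y = y * x) (hAM : ¬ A ≤ M) :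
    IsChiefFactor A (A ⊓ M) := by
  have htop : M ⊔ A = ⊤ := hM.2 _ (lt_of_le_of_ne le_sup_left fun h => hAM (h ▸ le_sup_right))
  have hconj : ∀ g x : X, x ∈ A ↔ g * x * g⁻¹ ∈ A := fun g x =>
    ⟨fun h => ‹A.Normal›.conj_mem x h g,
      fun h => by simpa [mul_assoc] using ‹A.Normal›.conj_mem _ h g⁻¹⟩
  refine ⟨inferInstance, ?_, lt_of_le_of_ne inf_le_left fun h => hAM (h ▸ inf_le_right), ?_⟩
  -- `M` normalizes `A ⊓ M` because `A` is normal, and `A` does because it is abelian; together they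
  -- generate `X`.
  · rw [← Subgroup.normalizer_eq_top_iff, eq_top_iff, ← htop, sup_le_iff]
    refine ⟨fun m hm => ?_, fun a ha => ?_⟩
    · rw [Subgroup.mem_normalizer_iff]
      intro x
      have h2 : x ∈ M ↔ m * x * m⁻¹ ∈ M := by
        rw [M.mul_mem_cancel_right (M.inv_mem hm), M.mul_mem_cancel_left hm]
      simp only [Subgroup.mem_inf]
      rw [← hconj m x, ← h2]
    · rw [Subgroup.mem_normalizer_iff]
      intro x
      have h1 := hconj a x
      by_cases hx : x ∈ A
      · rw [hA a ha x hx, mul_inv_cancel_right]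
      · simp only [Subgroup.mem_inf]
        tauto
  · intro L hL hL1 hL2
    by_cases hLM : L ≤ M
    · exact Or.inl (le_antisymm (le_inf hL2 hLM) hL1)
    · right
      have htop' : L ⊔ M = ⊤ := hM.2 _ (lt_of_le_of_ne le_sup_right fun h => hLM (h ▸ le_sup_left))
      refine le_antisymm hL2 fun a ha => ?_
      obtain ⟨l, hl, m, hm, rfl⟩ := 
        Subgroup.mem_sup_of_normal_left.mp (htop'.ge (Subgroup.mem_top a))
      exact L.mul_mem hl (hL1 ⟨(A.mul_mem_cancel_left (hL2 hl)).mp ha, hm⟩)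

variable {E Ω N : Type u} [Group E] [MulAction E Ω] [CommGroup N]

theorem inl_mul_comm_of_ker {x y : (Ω → N) ⋊[mulAutArrow] E}
    (hx : x ∈ (SemidirectProduct.rightHom : (Ω → N) ⋊[mulAutArrow] E →* E).ker)
    (hy : y ∈ (SemidirectProduct.rightHom : (Ω → N) ⋊[mulAutArrow] E →* E).ker) :
    x * y = y * x := by
  rw [← SemidirectProduct.range_inl_eq_ker_rightHom] at hx hy
  obtain ⟨f, rfl⟩ := hx
  obtain ⟨g, rfl⟩ := hy
  rw [← map_mul, mul_comm, map_mul]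

theorem mulAutArrow_mulSingle [DecidableEq Ω] (e : E) (w : Ω) (n : N) :
    mulAutArrow e (Pi.mulSingle w n : Ω → N) = Pi.mulSingle (e • w) n := by
  funext x
  change (Pi.mulSingle w n : Ω → N) (e⁻¹ • x) = _
  by_cases h : x = e • w
  · subst h
    simp
  · rw [Pi.mulSingle_eq_of_ne h, Pi.mulSingle_eq_of_ne]
    rintro rfl
    simp at h

variable [Finite E] [Finite Ω] [Finite N]

/-- A saturated formation containing `N` and `E` contains the permutational wreath product of
an abelian `p`-group `N` by `E`, if some normal `p`-subgroup of `E` is transitive. -/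
theorem IsSaturatedFormation.wreathProduct (hF : IsSaturatedFormation F) [Nonempty Ω]
    (hN : F N) (hE : F E) {p : ℕ} [Fact p.Prime] (hNp : IsPGroup p N) (V : Subgroup E) [V.Normal]
    (hV : IsPGroup p V) (htr : ∀ x y : Ω, ∃ v ∈ V, v • x = y) :
    F ((Ω → N) ⋊[mulAutArrow] E) := by
  classical
  cases nonempty_fintype Ω
  obtain ⟨w₀⟩ := (inferInstance : Nonempty Ω)
  let X := (Ω → N) ⋊[mulAutArrow] E
  let A : Subgroup X := SemidirectProduct.rightHom.ker
  let P : Subgroup X := V.comap SemidirectProduct.rightHom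
  have hAP : A ≤ P := MonoidHom.ker_le_comap _ _
  have hfun : IsPGroup p (Ω → N) := by
    obtain ⟨k, hk⟩ := IsPGroup.iff_card.mp hNp
    exact IsPGroup.of_card (n := k * Nat.card Ω) (by rw [Nat.card_fun, hk, pow_mul])
  have hP : IsPGroup p P := by
    refine hV.comap_of_ker_isPGroup _ ?_
    rw [← SemidirectProduct.range_inl_eq_ker_rightHom]
    exact hfun.of_surjective (MonoidHom.rangeRestrict _) (MonoidHom.rangeRestrict_surjective _)
  have hPn : Group.IsNilpotent P := hP.isNilpotent
  let τ : (Ω → N) →* N :=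
    { toFun := fun f => ∏ w, f w
      map_one' := by simp
      map_mul' := fun f g => by simp [Finset.prod_mul_distrib] }
  let σ : X →* N := SemidirectProduct.lift τ 1 (by
    intro g
    refine MonoidHom.ext fun f => ?_
    change ∏ w, f (g⁻¹ • w) = (1 : N) * (∏ w, f w) * (1 : N)⁻¹
    rw [Fintype.prod_equiv (MulAction.toPerm g⁻¹) (fun w => f (g⁻¹ • w)) f (fun _ => rfl)]
    simp)
  let q : X →* N × E := σ.prod SemidirectProduct.rightHom
  have hσ : ∀ f, σ (SemidirectProduct.inl f) = ∏ w, f w := fun f =>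
    SemidirectProduct.lift_inl _ _ _ _
  have hq : Function.Surjective q := by
    rintro ⟨n, e⟩
    refine ⟨SemidirectProduct.inl (Pi.mulSingle w₀ n) * SemidirectProduct.inr e, ?_⟩
    have h1 : σ (SemidirectProduct.inr e) = 1 := SemidirectProduct.lift_inr _ _ _ _
    ext
    · change σ _ = n
      rw [map_mul, h1, hσ]
      simp
    · change SemidirectProduct.rightHom (SemidirectProduct.inl _ * SemidirectProduct.inr e) = e
      rw [map_mul, SemidirectProduct.rightHom_inl, SemidirectProduct.rightHom_inr, one_mul]
  have hFq : F (X ⧸ q.ker) :=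
    hF.iso _ _ (QuotientGroup.quotientKerEquivOfSurjective q hq).symm (hF.prod hN hE)
  -- By transitivity of `V`, modulo `⁅A, P⁆` every coordinate can be moved to `w₀`. There `f`
  -- becomes the product of its values, which is `1` on the kernel.
  have hcomm : ∀ x ∈ q.ker, x ∈ ⁅A, P⁆ := by
    intro x hx
    have hx1 : σ x = 1 := congrArg Prod.fst (MonoidHom.mem_ker.mp hx)
    have hx2 : x ∈ A := congrArg Prod.snd (MonoidHom.mem_ker.mp hx)
    have hx3 : x ∈ (SemidirectProduct.rightHom : X →* E).ker := hx2
    rw [← SemidirectProduct.range_inl_eq_ker_rightHom] at hx3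
    obtain ⟨f, rfl⟩ := hx3
    rw [hσ] at hx1
    let K₀ : Subgroup (Ω → N) := ⁅A, P⁆.comap SemidirectProduct.inl
    let r := QuotientGroup.mk' K₀
    have hr : ∀ w n, r (Pi.mulSingle w n) = r (Pi.mulSingle w₀ n) := by
      intro w n
      obtain ⟨v, hv, rfl⟩ := htr w₀ w
      rw [← mulAutArrow_mulSingle, ← mul_inv_eq_one, ← map_inv, ← map_mul, ← MonoidHom.mem_ker,
        QuotientGroup.ker_mk', Subgroup.mem_comap, map_mul, map_inv, SemidirectProduct.inl_aut,
        Subgroup.commutator_comm, map_inv]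
      exact Subgroup.commutator_mem_commutator (g₁ := (SemidirectProduct.inr v : X))
        (g₂ := SemidirectProduct.inl (Pi.mulSingle w₀ n)) hv (SemidirectProduct.rightHom_inl _)
    change f ∈ K₀
    rw [← QuotientGroup.ker_mk' K₀, MonoidHom.mem_ker, ← Finset.univ_prod_mulSingle f, map_prod]
    change ∏ w, r (Pi.mulSingle w (f w)) = 1
    simp_rw [hr]
    rw [← map_prod]
    have : ∏ w, (Pi.mulSingle w₀ (f w) : Ω → N) = 1 :=
      (map_prod (MonoidHom.mulSingle (fun _ : Ω => N) w₀) f _).symm.trans (by rw [hx1, map_one])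
    rw [this, map_one]
  -- A maximal `M` not containing `A` cuts out the chief factor `A / (A ⊓ M)`, which the `p`-group
  -- `P` centralizes, so `⁅A, P⁆ ≤ M`.
  have hker : q.ker ≤ frattini X := by
    refine le_iInf₂ fun M hM x hx => ?_
    by_cases hAM : A ≤ M
    · exact hAM (congrArg Prod.snd (MonoidHom.mem_ker.mp hx))
    · exact (((hM.isChiefFactor_inf (fun _ h _ h' => inl_mul_comm_of_ker h h') hAM
        ).commutator_le_of_isNilpotent hPn hAP).trans inf_le_right) (hcomm x hx)
  refine hF.saturated X (hF.toIsFormation.of_surjective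
    (QuotientGroup.map q.ker (frattini X) (MonoidHom.id X) hker) ?_ hFq)
  exact QuotientGroup.map_surjective_of_surjective _ _ _ (QuotientGroup.mk_surjective) _

end Wreath

/-! ### From a regular orbit to split extensions of irreducible modules. -/

section RegularExtension

/-- `D` acts on some finite `p`-group `V` with a regular orbit, such that `V ⋊ D` lies in `F`. -/
def HasRegularExtension (F : GroupClass.{u}) (p : ℕ) (D : Type u) [Group D] : Prop :=
  ∃ (V : Type u) (_ : Group V) (_ : Finite V) (a : D →* MulAut V) (v₀ : V),
    IsPGroup p V ∧ F (V ⋊[a] D) ∧ ∀ d, a d v₀ = v₀ → d = 1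

variable {F : GroupClass.{u}} {p : ℕ}

theorem hasRegularExtension_punit (hF : IsFormation F) (hF1 : F PUnit.{u + 1}) :
    HasRegularExtension F p PUnit.{u + 1} := by
  refine ⟨PUnit, inferInstance, inferInstance, 1, 1, IsPGroup.of_subsingleton _ _, ?_,
    fun _ _ => rfl⟩
  exact hF.of_surjective (1 : PUnit →* _) (fun x => ⟨1, rfl⟩) hF1

theorem HasRegularExtension.prod (hF : IsFormation F) {D₁ D₂ : Type u} [Group D₁] [Group D₂]
    [Finite D₁] [Finite D₂] (h₁ : HasRegularExtension F p D₁) (h₂ : HasRegularExtension F p D₂) :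
    HasRegularExtension F p (D₁ × D₂) := by
  obtain ⟨V₁, _, _, a₁, v₁, hp₁, hF₁, hr₁⟩ := h₁
  obtain ⟨V₂, _, _, a₂, v₂, hp₂, hF₂, hr₂⟩ := h₂
  let a : D₁ × D₂ →* MulAut (V₁ × V₂) :=
    { toFun := fun d => (a₁ d.1).prodCongr (a₂ d.2)
      map_one' := MulEquiv.ext fun x => by
        change (a₁ 1 x.1, a₂ 1 x.2) = x
        simp
      map_mul' := fun d e => MulEquiv.ext fun x => by
        change (a₁ (d.1 * e.1) x.1, a₂ (d.2 * e.2) x.2) = (a₁ d.1 (a₁ e.1 x.1), a₂ d.2 (a₂ e.2 x.2))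
        simp }
  refine ⟨V₁ × V₂, inferInstance, inferInstance, a, (v₁, v₂), ?_, ?_, ?_⟩
  · rintro ⟨x, y⟩
    obtain ⟨k, hk⟩ := hp₁ x
    obtain ⟨l, hl⟩ := hp₂ y
    refine ⟨k + l, Prod.ext ?_ ?_⟩
    · simp [pow_add, pow_mul, hk]
    · simp [pow_add, pow_mul' y, hl]
  · let f : (V₁ ⋊[a₁] D₁) × (V₂ ⋊[a₂] D₂) →* (V₁ × V₂) ⋊[a] (D₁ × D₂) :=
      { toFun := fun x => ⟨(x.1.left, x.2.left), (x.1.right, x.2.right)⟩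
        map_one' := rfl
        map_mul' := fun x y => rfl }
    refine hF.of_surjective f ?_ (hF.prod hF₁ hF₂)
    rintro ⟨⟨x, y⟩, ⟨d, e⟩⟩
    exact ⟨(⟨x, d⟩, ⟨y, e⟩), rfl⟩
  · rintro ⟨d, e⟩ h
    exact Prod.ext (hr₁ d (congrArg Prod.fst h)) (hr₂ e (congrArg Prod.snd h))

/-- The natural affine action of `V ⋊ D` on `V`. -/
@[reducible]
def SemidirectProduct.affineAction {V D : Type*} [Group V] [Group D] (a : D →* MulAut V) :
    MulAction (V ⋊[a] D) V where
  smul e v := e.left * a e.right v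
  one_smul v := by
    change (1 : V) * a 1 v = v
    simp
  mul_smul e f v := by
    change (e * f).left * a (e * f).right v = e.left * a e.right (f.left * a f.right v)
    simp [mul_assoc]

/-- Lets equivariance be checked separately on a lift `s` from `D` and on `g * s⁻¹`, which acts
through the kernel `P`. -/
theorem conj_eq_conj_mul_inv_conj {X : Type*} [Group X] (g s x : X) :
    g * x * g⁻¹ = g * s⁻¹ * (s * x * s⁻¹) * (g * s⁻¹)⁻¹ := by
  group

/-- If `D` has a regular extension in the saturated formation `F`, then `F` contains the split
extension of every irreducible `p`-module by `D`. -/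
theorem HasRegularExtension.semidirectProduct (hF : IsSaturatedFormation F) [Fact p.Prime]
    {D : Type u} [Group D] [Finite D] (h : HasRegularExtension F p D) {N : Type u} [CommGroup N]
    [Finite N] [Nontrivial N] (hN : F N) (hNp : IsPGroup p N) (b : D →* MulAut N)
    (hirr : ∀ W : Subgroup N, (∀ d, ∀ n ∈ W, b d n ∈ W) → W = ⊥ ∨ W = ⊤) : F (N ⋊[b] D) := by
  classical
  obtain ⟨V, _, _, a, v₀, hVp, hE, hreg⟩ := h
  cases nonempty_fintype D
  let E := V ⋊[a] D
  let _ : MulAction E V := SemidirectProduct.affineAction a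
  let V' : Subgroup E := (SemidirectProduct.rightHom : E →* D).ker
  have hV' : IsPGroup p V' := by
    change IsPGroup p (SemidirectProduct.rightHom : E →* D).ker
    rw [← SemidirectProduct.range_inl_eq_ker_rightHom]
    exact hVp.of_surjective (MonoidHom.rangeRestrict _) (MonoidHom.rangeRestrict_surjective _)
  let X := (V → N) ⋊[mulAutArrow] E
  have hX : F X := by
    refine hF.wreathProduct hN hE hNp V' hV' fun x y => ⟨SemidirectProduct.inl (y * x⁻¹), ?_, ?_⟩
    · exact SemidirectProduct.rightHom_inl _
    · change y * x⁻¹ * a 1 x = y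
      simp
  let A : Subgroup X := (SemidirectProduct.rightHom : X →* E).ker
  let π : X →* D := SemidirectProduct.rightHom.comp SemidirectProduct.rightHom
  have hπ : Function.Surjective π :=
    SemidirectProduct.rightHom_surjective.comp SemidirectProduct.rightHom_surjective
  let P : Subgroup X := π.ker
  have hAP : A ≤ P := fun x hx => by
    have hx' : SemidirectProduct.rightHom x = 1 := hx
    change SemidirectProduct.rightHom (SemidirectProduct.rightHom x) = 1
    rw [hx', map_one]
  have hfun : IsPGroup p (V → N) := by
    obtain ⟨k, hk⟩ := IsPGroup.iff_card.mp hNp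
    exact IsPGroup.of_card (n := k * Nat.card V) (by rw [Nat.card_fun, hk, pow_mul])
  have hP : IsPGroup p P := by
    refine hV'.comap_of_ker_isPGroup (SemidirectProduct.rightHom : X →* E) ?_
    rw [← SemidirectProduct.range_inl_eq_ker_rightHom]
    exact hfun.of_surjective (MonoidHom.rangeRestrict _) (MonoidHom.rangeRestrict_surjective _)
  have hPn : Group.IsNilpotent P := hP.isNilpotent
  -- Averaging over the orbit of `v₀` makes `φ` commute with `D`. Regularity leaves only the term `d
  -- = 1` on functions supported at `v₀`, so `φ` is onto. It need not respect the action of `V`.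
  let φ : (V → N) →* N :=
    { toFun := fun f => ∏ d, b d (f (a d v₀))
      map_one' := by simp
      map_mul' := fun f g => by simp [Finset.prod_mul_distrib] }
  have hφ : ∀ f, φ f = ∏ d, b d (f (a d v₀)) := fun _ => rfl
  have hφ1 : ∀ n, φ (Pi.mulSingle v₀ n) = n := by
    intro n
    rw [hφ, Finset.prod_eq_single 1]
    · rw [map_one, map_one, MulAut.one_apply, MulAut.one_apply, Pi.mulSingle_eq_same]
    · intro d _ hd
      rw [Pi.mulSingle_eq_of_ne (fun h => hd (hreg d h)), map_one]
    · simp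
  have hφb : ∀ d f, φ (mulAutArrow (SemidirectProduct.inr d : E) f) = b d (φ f) := by
    intro d f
    have hval : ∀ v, mulAutArrow (SemidirectProduct.inr d : E) f v = f (a d⁻¹ v) := by
      intro v
      change f ((SemidirectProduct.inr d : E)⁻¹.left * a (SemidirectProduct.inr d : E)⁻¹.right v) = _
      simp
    rw [hφ, hφ, map_prod]
    refine Fintype.prod_equiv (Equiv.mulLeft d⁻¹) _ _ fun e => ?_
    rw [hval, Equiv.coe_mulLeft, ← MulAut.mul_apply, ← map_mul, ← MulAut.mul_apply N (b d), ← map_mul,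
      mul_inv_cancel_left]
  have hmul : ∀ x ∈ A, ∀ y, φ (x * y).left = φ x.left * φ y.left := by
    intro x hx y
    have hx' : x.right = 1 := hx
    rw [SemidirectProduct.mul_left, hx', map_one, map_mul]
    rfl
  obtain ⟨n₁, hn₁⟩ := exists_ne (1 : N)
  -- Minimality forces `φ` to vanish on any `M` with `B / M` chief. Since `P` centralizes `B / M`,
  -- the restriction of `φ` to `B` is `P`-invariant, hence equivariant for all of `X`.
  obtain ⟨B, ⟨hBn, hBA, x₁, hx₁B, hx₁⟩, hmin⟩ := (Set.toFinite {B : Subgroup X | B.Normal ∧ B ≤ A ∧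
    ∃ x ∈ B, φ x.left ≠ 1}).exists_minimal ⟨A, MonoidHom.normal_ker _, le_rfl,
      SemidirectProduct.inl (Pi.mulSingle v₀ n₁), SemidirectProduct.rightHom_inl _, by
        rwa [SemidirectProduct.left_inl, hφ1]⟩
  have hB0 : ⊥ < B := by
    rw [bot_lt_iff_ne_bot]
    rintro rfl
    rw [Subgroup.mem_bot] at hx₁B
    subst hx₁B
    exact hx₁ (by simp)
  obtain ⟨M, -, hchief⟩ := exists_isChiefFactor_of_lt' hBn inferInstance hB0
  have hM : ∀ x ∈ M, φ x.left = 1 := by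
    intro x hx
    by_contra hne
    exact hchief.lt.not_ge (hmin ⟨hchief.normal_bot, hchief.lt.le.trans hBA, x, hx, hne⟩
      hchief.lt.le)
  have hcomm : ⁅P, B⁆ ≤ M := by
    rw [Subgroup.commutator_comm]
    exact hchief.commutator_le_of_isNilpotent hPn (hBA.trans hAP)
  have hPinv : ∀ y ∈ P, ∀ x ∈ B, φ (y * x * y⁻¹).left = φ x.left := by
    intro y hy x hx
    have h1 : y * x * y⁻¹ * x⁻¹ ∈ M := hcomm (Subgroup.commutator_mem_commutator hy hx)
    rw [← inv_mul_cancel_right (y * x * y⁻¹) x, hmul _ (hBA (hchief.lt.le h1)), hM _ h1, one_mul]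
  have hDinv : ∀ d : D, ∀ x ∈ B,
      φ (SemidirectProduct.inr (SemidirectProduct.inr d) * x *
        (SemidirectProduct.inr (SemidirectProduct.inr d))⁻¹ : X).left = b d (φ x.left) := by
    intro d x hx
    have hx' : x ∈ (SemidirectProduct.rightHom : X →* E).ker := hBA hx
    rw [← SemidirectProduct.range_inl_eq_ker_rightHom] at hx'
    obtain ⟨f, rfl⟩ := hx'
    rw [← map_inv, ← SemidirectProduct.inl_aut, SemidirectProduct.left_inl,
      SemidirectProduct.left_inl, hφb]
  have hequiv : ∀ g : X, ∀ x ∈ B, φ (g * x * g⁻¹).left = b (π g) (φ x.left) := by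
    intro g x hx
    let s : X := SemidirectProduct.inr (SemidirectProduct.inr (π g))
    have hs : π s = π g := by
      change SemidirectProduct.rightHom (SemidirectProduct.rightHom (SemidirectProduct.inr
        (SemidirectProduct.inr (π g)) : X)) = _
      rw [SemidirectProduct.rightHom_inr, SemidirectProduct.rightHom_inr]
    have hy : g * s⁻¹ ∈ P := by
      exact (MonoidHom.map_mul_inv π g s).trans (by rw [hs, mul_inv_cancel])
    rw [← hDinv (π g) x hx, ← hPinv _ hy _ (hBn.conj_mem x hx s)]
    congr 2
    exact conj_eq_conj_mul_inv_conj g s x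
  let β : B →* N :=
    { toFun := fun x => φ (x : X).left
      map_one' := by simp
      map_mul' := fun x y => by
        rw [Subgroup.coe_mul, hmul _ (hBA x.2)] }
  have hβ : Function.Surjective β := by
    rw [← MonoidHom.range_eq_top]
    refine (hirr β.range ?_).resolve_left ?_
    · rintro d _ ⟨x, rfl⟩
      obtain ⟨g, rfl⟩ := hπ d
      exact ⟨⟨g * x * g⁻¹, hBn.conj_mem x x.2 g⟩, hequiv g x x.2⟩
    · intro hbot
      exact hx₁ ((Subgroup.eq_bot_iff_forall _).mp hbot _ ⟨⟨x₁, hx₁B⟩, rfl⟩)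
  refine hF.toIsFormation.of_surjective (SemidirectProduct.map β π fun g => ?_) ?_
    (hF.toIsFormation.semidirectProduct_conjNormal hX B)
  · refine MonoidHom.ext fun x => ?_
    change φ ((MulAut.conjNormal g x : B) : X).left = b (π g) (φ (x : X).left)
    rw [MulAut.conjNormal_apply]
    exact hequiv g x x.2
  · rintro ⟨n, d⟩
    obtain ⟨x, rfl⟩ := hβ n
    obtain ⟨g, rfl⟩ := hπ d
    exact ⟨⟨x, g⟩, rfl⟩

end RegularExtension

/-! ### Groups with an irreducible group of automorphisms. -/

section IrreducibleAction

variable {G N : Type*} [Group G] [Group N] {ρ : G →* MulAut N}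

/-- `N` has no proper nontrivial subgroup invariant under the action `ρ`. -/
def IsIrreducibleAction (ρ : G →* MulAut N) : Prop :=
  ∀ W : Subgroup N, (∀ g, ∀ n ∈ W, ρ g n ∈ W) → W = ⊥ ∨ W = ⊤

/-- By `hT` the common fixed points of `T` form an invariant subgroup. `T` is a mere set so as to
cover both a normal subgroup and a single element with central image. -/
theorem IsIrreducibleAction.eq_one_of_fixed (hρ : IsIrreducibleAction ρ) (T : Set G)
    (hT : ∀ g, ∀ t ∈ T, ∃ t' ∈ T, ρ t * ρ g = ρ g * ρ t') {n₀ : N} (hn₀ : n₀ ≠ 1)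
    (hfix : ∀ t ∈ T, ρ t n₀ = n₀) : ∀ t ∈ T, ρ t = 1 := by
  let W : Subgroup N :=
    { carrier := {n | ∀ t ∈ T, ρ t n = n}
      one_mem' := fun t _ => map_one _
      mul_mem' := fun hx hy t ht => by rw [map_mul, hx t ht, hy t ht]
      inv_mem' := fun hx t ht => by rw [map_inv, hx t ht] }
  have hW : W = ⊤ := by
    refine (hρ W fun g n hn t ht => ?_).resolve_left fun h => ?_
    · obtain ⟨t', ht', h⟩ := hT g t ht
      rw [← MulAut.mul_apply, h, MulAut.mul_apply, hn t' ht']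
    · exact hn₀ ((Subgroup.eq_bot_iff_forall W).mp h n₀ hfix)
  intro t ht
  ext n
  exact (hW.ge (Subgroup.mem_top n) : n ∈ W) t ht

theorem IsIrreducibleAction.exists_prime_pow_eq_one (hρ : IsIrreducibleAction ρ) [Finite N]
    [Nontrivial N] (hN : ∀ x y : N, x * y = y * x) : ∃ p : ℕ, p.Prime ∧ ∀ n : N, n ^ p = 1 := by
  obtain ⟨p, hp, hdvd⟩ := Nat.exists_prime_and_dvd (Finite.one_lt_card (α := N)).ne'
  have := Fact.mk hp
  obtain ⟨x, hx⟩ := exists_prime_orderOf_dvd_card' p hdvd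
  let W : Subgroup N :=
    { carrier := {n | n ^ p = 1}
      one_mem' := one_pow p
      mul_mem' := fun {x y} hx hy => by
        change (x * y) ^ p = 1
        rw [Commute.mul_pow (hN x y), hx, hy, one_mul]
      inv_mem' := fun {x} hx => by
        change x⁻¹ ^ p = 1
        rw [inv_pow, hx, inv_one] }
  have hW : W = ⊤ := by
    refine (hρ W fun g n hn => ?_).resolve_left fun h => ?_
    · change ρ g n ^ p = 1
      rw [← map_pow, hn, map_one]
    · have h1 : x = 1 := (Subgroup.eq_bot_iff_forall W).mp h x (by
        change x ^ p = 1
        rw [← hx, pow_orderOf_eq_one])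
      rw [h1, orderOf_one] at hx
      exact hp.one_lt.ne hx
  exact ⟨p, hp, fun n => hW.ge (Subgroup.mem_top n)⟩

theorem Subgroup.isSolvable_sup {S W : Subgroup N} [S.Normal] (hS : Group.IsSolvable S)
    (hW : Group.IsSolvable W) : Group.IsSolvable (W ⊔ S : Subgroup N) := by
  rw [Group.isSolvable_iff_subgroup_quotient (S.subgroupOf (W ⊔ S))]
  refine ⟨?_, ?_⟩
  · exact Group.isSolvable_of_isSolvable_injective
      (f := MulEquiv.toMonoidHom (Subgroup.subgroupOfEquivOfLe (le_sup_right : S ≤ W ⊔ S)))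
      (Subgroup.subgroupOfEquivOfLe (le_sup_right : S ≤ W ⊔ S)).injective
  · exact Group.isSolvable_of_surjective
      (f := MulEquiv.toMonoidHom (QuotientGroup.quotientInfEquivProdNormalQuotient W S))
      (QuotientGroup.quotientInfEquivProdNormalQuotient W S).surjective

/-- An irreducible group with a nontrivial abelian normal subgroup is abelian. -/
theorem IsIrreducibleAction.comm_of_normal_comm (hρ : IsIrreducibleAction ρ) [Finite N]
    {W : Subgroup N} [W.Normal] (hW : W ≠ ⊥) (hcomm : ∀ x y : W, x * y = y * x) (x y : N) :
    x * y = y * x := by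
  -- `S` is the soluble radical and contains all translates of `W`. Irreducibility gives `S = ⊤`,
  -- and then the derived subgroup, proper and invariant, is trivial.
  obtain ⟨S, ⟨hSn, hS⟩, hmax⟩ := (Set.toFinite {S : Subgroup N | S.Normal ∧ Group.IsSolvable S}
    ).exists_maximal ⟨⊥, inferInstance, inferInstance⟩
  have hle : ∀ g, W.map (ρ g).toMonoidHom ≤ S := by
    intro g
    have hn : (W.map (ρ g).toMonoidHom).Normal := Subgroup.Normal.map inferInstance _
      (ρ g).surjective
    have hWs : Group.IsSolvable W := Group.isSolvable_of_comm hcomm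
    have hs : Group.IsSolvable (W.map (ρ g).toMonoidHom) :=
      Group.isSolvable_of_surjective
        (f := (W.equivMapOfInjective (ρ g).toMonoidHom (ρ g).injective).toMonoidHom)
        (W.equivMapOfInjective (ρ g).toMonoidHom (ρ g).injective).surjective
    exact le_sup_left.trans (hmax ⟨inferInstance, Subgroup.isSolvable_sup hS hs⟩ le_sup_right)
  let U : Subgroup N :=
    { carrier := {n | ∀ g, ρ g n ∈ S}
      one_mem' := fun g => by rw [map_one]; exact S.one_mem
      mul_mem' := fun hx hy g => by rw [map_mul]; exact S.mul_mem (hx g) (hy g)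
      inv_mem' := fun hx g => by rw [map_inv]; exact S.inv_mem (hx g) }
  have hWU : W ≤ U := fun w hw g => hle g ⟨w, hw, rfl⟩
  have hU : U = ⊤ := by
    refine (hρ U fun g n hn g' => ?_).resolve_left fun h => hW (le_bot_iff.mp (h ▸ hWU))
    rw [← MulAut.mul_apply, ← map_mul]
    exact hn _
  have hST : S = ⊤ := by
    rw [eq_top_iff]
    intro n _
    simpa using (hU.ge (Subgroup.mem_top n) : n ∈ U) 1
  subst hST
  have hNs : Group.IsSolvable N := Group.isSolvable_of_surjective
    (f := (Subgroup.topEquiv : _ ≃* N).toMonoidHom) Subgroup.topEquiv.surjective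
  have hNt : Nontrivial N := by
    obtain ⟨w, hw⟩ := Subgroup.ne_bot_iff_exists_ne_one.mp hW
    exact ⟨⟨w, 1, fun h => hw (Subtype.ext h)⟩⟩
  have hbot : commutator N = ⊥ := by
    refine (hρ (commutator N) fun g n hn => ?_).resolve_right
      (Group.IsSolvable.commutator_lt_top_of_nontrivial N).ne
    exact (Subgroup.characteristic_iff_le_comap.mp (inferInstance : (commutator N).Characteristic)
      (ρ g)) hn
  have h := (Subgroup.eq_bot_iff_forall _).mp hbot _
    (Subgroup.commutator_mem_commutator (Subgroup.mem_top x) (Subgroup.mem_top y))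
  exact commutatorElement_eq_one_iff_mul_comm.mp h

theorem Subgroup.eq_bot_or_eq_of_le_of_isSimpleGroup {S W : Subgroup N} [S.Normal]
    (hW : IsSimpleGroup W) (h : S ≤ W) : S = ⊥ ∨ S = W := by
  rcases (inferInstance : (S.subgroupOf W).Normal).eq_bot_or_eq_top with h1 | h1
  · exact Or.inl (le_bot_iff.mp ((inf_eq_left.mpr h).ge.trans
      (Subgroup.subgroupOf_eq_bot.mp h1).le_bot))
  · exact Or.inr (le_antisymm h (Subgroup.subgroupOf_eq_top.mp h1))

/-- If `G = H K` acts irreducibly on `N`, and `N` has nonabelian simple normal subgroups invariant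
under the normal subgroups `H` and `K` respectively, then `N` is simple. -/
theorem IsIrreducibleAction.isSimpleGroup (hρ : IsIrreducibleAction ρ) {H K : Subgroup G}
    [K.Normal] (hHK : ∀ g, ∃ h ∈ H, ∃ k ∈ K, h * k = g) {W W' : Subgroup N} [W.Normal]
    [W'.Normal] (hW : IsSimpleGroup W) (hWc : ¬ ∀ x y : W, x * y = y * x)
    (hW' : IsSimpleGroup W') (hH : ∀ h ∈ H, ∀ n ∈ W, ρ h n ∈ W)
    (hK : ∀ k ∈ K, ∀ n ∈ W', ρ k n ∈ W') : IsSimpleGroup N := by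
  -- Otherwise the elements all of whose translates centralize `W` form a nontrivial invariant
  -- subgroup, hence all of `N`, and `W` is abelian.
  obtain ⟨g, hg⟩ : ∃ g, ¬ W'.map (ρ g).toMonoidHom ≤ Subgroup.centralizer W := by
    by_contra! hall
    let U : Subgroup N :=
      { carrier := {n | ∀ g, ρ g n ∈ Subgroup.centralizer (W : Set N)}
        one_mem' := fun g => by rw [map_one]; exact Subgroup.one_mem _
        mul_mem' := fun hx hy g => by rw [map_mul]; exact Subgroup.mul_mem _ (hx g) (hy g)
        inv_mem' := fun hx g => by rw [map_inv]; exact Subgroup.inv_mem _ (hx g) }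
    have hWU : W' ≤ U := fun w hw g => hall g ⟨w, hw, rfl⟩
    have hU : U = ⊤ := by
      refine (hρ U fun g n hn g' => ?_).resolve_left fun h => ?_
      · rw [← MulAut.mul_apply, ← map_mul]
        exact hn _
      · have hb : W' = ⊥ := le_bot_iff.mp (h ▸ hWU)
        exact (Subgroup.nontrivial_iff_ne_bot W').mp hW'.toNontrivial hb
    refine hWc fun x y => Subtype.ext ?_
    have hy := (hU.ge (Subgroup.mem_top (y : N)) : (y : N) ∈ U) 1
    rw [map_one] at hy
    exact Subgroup.mem_centralizer_iff.mp hy x x.2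
  let W₁ := W'.map (ρ g).toMonoidHom
  have hW₁n : W₁.Normal := Subgroup.Normal.map inferInstance _ (ρ g).surjective
  have hW₁ : IsSimpleGroup W₁ :=
    (W'.equivMapOfInjective (ρ g).toMonoidHom (ρ g).injective).symm.isSimpleGroup
  have hne : W₁ ⊓ W ≠ ⊥ := by
    intro h
    apply hg
    rw [← Subgroup.commutator_eq_bot_iff_le_centralizer]
    exact le_bot_iff.mp ((Subgroup.commutator_le_inf W₁ W).trans h.le)
  have h1 := (Subgroup.eq_bot_or_eq_of_le_of_isSimpleGroup hW₁ inf_le_left).resolve_left hne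
  have h2 := (Subgroup.eq_bot_or_eq_of_le_of_isSimpleGroup hW inf_le_right).resolve_left hne
  have h3 : W₁ = W := h1.symm.trans h2
  -- Normality of `K` carries `K`-invariance from `W'` to its translate.
  have hKW : ∀ k ∈ K, ∀ n ∈ W, ρ k n ∈ W := by
    intro k hk n hn
    rw [← h3] at hn ⊢
    obtain ⟨m, hm, rfl⟩ := hn
    refine ⟨ρ (g⁻¹ * k * g) m, hK _ (by simpa using ‹K.Normal›.conj_mem k hk g⁻¹) m hm, ?_⟩
    change ρ g (ρ (g⁻¹ * k * g) m) = ρ k (ρ g m)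
    rw [← MulAut.mul_apply, ← map_mul, ← MulAut.mul_apply, ← map_mul]
    congr 2
    group
  have hWtop : W = ⊤ := by
    refine (hρ W fun g n hn => ?_).resolve_left
      ((Subgroup.nontrivial_iff_ne_bot W).mp hW.toNontrivial)
    obtain ⟨h, hh, k, hk, rfl⟩ := hHK g
    rw [map_mul, MulAut.mul_apply]
    exact hH h hh _ (hKW k hk n hn)
  subst hWtop
  exact Subgroup.topEquiv.symm.isSimpleGroup

end IrreducibleAction

/-! ### Chief factors of a normal subgroup inside those of the group. -/

section ChiefFactors

theorem IsChiefFactor.nontrivial {G : Type u} [Group G] {A B : Subgroup G} (h : IsChiefFactor A B) 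
    : Nontrivial (NormalFactor A B) := by
  refine QuotientGroup.nontrivial_iff.mpr fun h' => ?_
  exact h.lt.not_ge (Subgroup.subgroupOf_eq_top.mp h')

variable {G : Type u} [Group G] {A B : Subgroup G} [A.Normal] [B.Normal]

theorem factorConj_mk (g : G) (a : A) :
    factorConj A B g (a : NormalFactor A B) = ((MulAut.conjNormal g a : A) : NormalFactor A B) :=
  rfl

theorem factorConj_coe_apply (a : A) (n : NormalFactor A B) :
    factorConj A B a n = (a : NormalFactor A B) * n * (a : NormalFactor A B)⁻¹ := by
  induction n using QuotientGroup.induction_on with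
  | H x =>
    rw [factorConj_mk, ← QuotientGroup.mk_mul, ← QuotientGroup.mk_inv, ← QuotientGroup.mk_mul]
    rfl

theorem IsChiefFactor.isIrreducibleAction (h : IsChiefFactor A B) :
    IsIrreducibleAction (factorConj A B) := by
  intro W hW
  let q := QuotientGroup.mk' (B.subgroupOf A)
  let L : Subgroup G := (W.comap q).map A.subtype
  have hmem : ∀ a : A, (a : G) ∈ L ↔ (a : NormalFactor A B) ∈ W := fun a =>
    ⟨fun ⟨b, hb, hba⟩ => (Subtype.ext hba : b = a) ▸ hb, fun ha => ⟨a, ha, rfl⟩⟩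
  have hLn : L.Normal := by
    refine ⟨?_⟩
    rintro _ ⟨a, ha, rfl⟩ g
    exact (hmem (MulAut.conjNormal g a)).mpr (hW g _ ha)
  have hBL : B ≤ L := fun b hb => (hmem ⟨b, h.lt.le hb⟩).mpr (by
    rw [(QuotientGroup.eq_one_iff _).mpr (Subgroup.mem_subgroupOf.mpr hb)]
    exact W.one_mem)
  have hLA : L ≤ A := Subgroup.map_subtype_le _
  rcases h.eq_or_eq L hLn hBL hLA with h1 | h1
  · left
    rw [eq_bot_iff]
    intro n hn
    induction n using QuotientGroup.induction_on with
    | H x =>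
      have hx := (hmem x).mpr hn
      rw [h1] at hx
      exact (QuotientGroup.eq_one_iff _).mpr (Subgroup.mem_subgroupOf.mpr hx)
  · right
    rw [eq_top_iff]
    intro n _
    induction n using QuotientGroup.induction_on with
    | H x => exact (hmem x).mp (h1.ge x.2)

/-- A normal subgroup `H` not centralizing the chief factor `A / B` of `G` has a chief factor that
embeds `H`-equivariantly as a normal subgroup of `A / B`. -/
theorem IsChiefFactor.exists_embedding [Finite G] (h : IsChiefFactor A B) (H : Subgroup G)
    [H.Normal] (hH : ¬ ∀ g ∈ H, factorConj A B g = 1) :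
    ∃ (M : Subgroup H) (_ : M.Normal) (ι : NormalFactor M (B.subgroupOf H) →* NormalFactor A B),
      IsChiefFactor M (B.subgroupOf H) ∧ Function.Injective ι ∧
      (∀ (g : H) x, ι (factorConj M (B.subgroupOf H) g x) = factorConj A B g (ι x)) ∧
      ι.range.Normal := by
  -- `⁅A, H⁆ ≤ A ⊓ H`, so otherwise `H` would centralize `A / B`.
  have hnle : ¬ A ⊓ H ≤ B := by
    intro hle
    refine hH fun g hg => MulEquiv.ext fun n => ?_
    induction n using QuotientGroup.induction_on with
    | H x =>
      rw [factorConj_mk, MulAut.one_apply]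
      refine (QuotientGroup.eq.mpr ?_).symm
      rw [Subgroup.mem_subgroupOf]
      change (x : G)⁻¹ * (g * x * g⁻¹) ∈ B
      refine hle ⟨A.mul_mem (A.inv_mem x.2) (‹A.Normal›.conj_mem x x.2 g), ?_⟩
      rw [← mul_assoc, ← mul_assoc]
      refine H.mul_mem ?_ (H.inv_mem hg)
      simpa using ‹H.Normal›.conj_mem g hg (x : G)⁻¹
  have hsup : (A ⊓ H) ⊔ B = A := by
    refine (h.eq_or_eq _ inferInstance le_sup_right (sup_le inf_le_left h.lt.le)).resolve_left ?_
    exact fun h' => hnle (le_sup_left.trans h'.le)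
  have hlt : B.subgroupOf H < A.subgroupOf H := by
    refine lt_of_le_not_ge (fun x hx => h.lt.le hx) fun hle => hnle fun x hx => ?_
    exact hle (show (⟨x, hx.2⟩ : H) ∈ A.subgroupOf H from hx.1)
  obtain ⟨M, hMA, hM⟩ := exists_isChiefFactor_of_lt inferInstance inferInstance hlt
  have hMn := hM.normal_top
  let j : M →* A :=
    { toFun := fun m => ⟨((m : H) : G), hMA m.2⟩
      map_one' := rfl
      map_mul' := fun _ _ => rfl }
  let ι : NormalFactor M (B.subgroupOf H) →* NormalFactor A B :=
    QuotientGroup.map _ _ j fun x hx => hx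
  have hequiv : ∀ (g : H) x, ι (factorConj M (B.subgroupOf H) g x) = factorConj A B g (ι x) := by
    intro g x
    induction x using QuotientGroup.induction_on with
    | H x => rfl
  refine ⟨M, hMn, ι, hM, ?_, hequiv, ⟨?_⟩⟩
  · rw [injective_iff_map_eq_one]
    intro x hx
    induction x using QuotientGroup.induction_on with
    | H x =>
      have hx' : ((j x : A) : NormalFactor A B) = 1 := hx
      rw [QuotientGroup.eq_one_iff] at hx' ⊢
      exact hx'
  -- Since `A = (A ⊓ H) B`, each inner automorphism of `A / B` comes from an element of `H`, under
  -- which the range of `ι` is stable.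
  · rintro _ ⟨x, rfl⟩ n
    induction n using QuotientGroup.induction_on with
    | H a =>
      obtain ⟨c, hc, b, hb, hcb⟩ := Subgroup.mem_sup_of_normal_left.mp (hsup.ge a.2)
      have hac : (a : NormalFactor A B) = ((⟨c, hc.1⟩ : A) : NormalFactor A B) := by
        refine (QuotientGroup.eq.mpr ?_).symm
        rw [Subgroup.mem_subgroupOf]
        change c⁻¹ * (a : G) ∈ B
        rw [← hcb, inv_mul_cancel_left]
        exact hb
      rw [hac, ← factorConj_coe_apply]
      exact ⟨_, hequiv ⟨c, hc.2⟩ x⟩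

end ChiefFactors

/-! ### Chief factors of a product of two normal `ca`-`F`-subgroups. -/

section Products

variable {F : GroupClass.{u}} {G : Type u} [Group G] [Finite G] {A B : Subgroup G} [A.Normal]
  [B.Normal]

/-- If the derived subgroup is quasinilpotent, then `G` acts on its abelian chief factors as an
abelian group. -/
theorem IsChiefFactor.factorConj_comm (h : IsChiefFactor A B) (hab : IsAbelianFactor A B)
    (hG : IsQuasinilpotent (commutator G)) (g₁ g₂ : G) :
    factorConj A B g₁ * factorConj A B g₂ = factorConj A B g₂ * factorConj A B g₁ := by
  have hcentral : ∀ g ∈ commutator G, factorConj A B g = 1 := by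
    by_contra hne
    obtain ⟨M, hMn, ι, hM, hι, hequiv, -⟩ := h.exists_embedding (commutator G) hne
    have := hM.nontrivial
    obtain ⟨n, hn⟩ := exists_ne (1 : NormalFactor M (B.subgroupOf (commutator G)))
    refine hne fun g hg => h.isIrreducibleAction.eq_one_of_fixed (commutator G : Set G) ?_
      (n₀ := ι n) ((map_ne_one_iff ι hι).mpr hn) ?_ g hg
    · intro g t ht
      refine ⟨g⁻¹ * t * g, by simpa using
        (inferInstance : (commutator G).Normal).conj_mem t ht g⁻¹, ?_⟩
      rw [← map_mul, ← map_mul]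
      congr 1
      group
    · intro t ht
      -- The induced automorphism is inner on a factor embedded in an abelian group, so it fixes
      -- `n`.
      obtain ⟨x, hx⟩ := hG M _ hM ⟨t, ht⟩
      rw [← hequiv ⟨t, ht⟩ n, hx]
      rw [MulAut.conj_apply, map_mul, map_mul, hab (ι x) (ι n), map_inv, mul_inv_cancel_right]
  have h1 := hcentral _ (Subgroup.commutator_mem_commutator (Subgroup.mem_top g₁)
    (Subgroup.mem_top g₂))
  rw [map_commutatorElement] at h1
  exact commutatorElement_eq_one_iff_mul_comm.mp h1

/-- The group induced on an abelian chief factor of `G` by a normal `ca`-`F`-subgroup has a regular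
extension in `F`. -/
theorem IsChiefFactor.exists_hasRegularExtension (hF : IsFormation F) (hF1 : F PUnit.{u + 1})
    (h : IsChiefFactor A B) (hab : IsAbelianFactor A B)
    (hcomm : ∀ g₁ g₂ : G,
      factorConj A B g₁ * factorConj A B g₂ = factorConj A B g₂ * factorConj A B g₁)
    {p : ℕ} (hp : IsPGroup p (NormalFactor A B)) (H : Subgroup G) [H.Normal] (hH : IsCaGroup F H) :
    ∃ (D : Type u) (_ : Group D) (_ : Finite D) (j : D →* G ⧸ factorCentralizer A B),
      HasRegularExtension F p D ∧ ∀ g ∈ H, ∃ d, j d = (g : G ⧸ factorCentralizer A B) := by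
  by_cases hHc : ∀ g ∈ H, factorConj A B g = 1
  · exact ⟨PUnit, inferInstance, inferInstance, 1, hasRegularExtension_punit hF hF1,
      fun g hg => ⟨1, ((QuotientGroup.eq_one_iff g).mpr (hHc g hg)).symm⟩⟩
  · obtain ⟨M, hMn, ι, hM, hι, hequiv, -⟩ := h.exists_embedding H hHc
    have hM0 := hM.nontrivial
    have hMab : IsAbelianFactor M (B.subgroupOf H) := fun x y => hι (by
      rw [map_mul, map_mul, hab])
    have hfix : ∀ (g : H) (n : NormalFactor M (B.subgroupOf H)), n ≠ 1 →
        factorConj M (B.subgroupOf H) g n = n → factorConj A B g = 1 := by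
      intro g n hn hgn
      refine h.isIrreducibleAction.eq_one_of_fixed {(g : G)} ?_ ((map_ne_one_iff ι hι).mpr hn) ?_
        g rfl
      · rintro g' t rfl
        exact ⟨g, rfl, hcomm _ _⟩
      · rintro t rfl
        rw [← hequiv, hgn]
    have hker : factorCentralizer M (B.subgroupOf H) ≤ (factorCentralizer A B).comap H.subtype := by
      intro g hg
      obtain ⟨n, hn⟩ := exists_ne (1 : NormalFactor M (B.subgroupOf H))
      exact hfix g n hn (by rw [show factorConj M (B.subgroupOf H) g = 1 from hg]; rfl)
    obtain ⟨v, hv⟩ := exists_ne (1 : NormalFactor M (B.subgroupOf H))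
    -- The embedded chief factor serves as the `p`-group. By `hfix` any nontrivial `v` has a regular
    -- orbit.
    refine ⟨H ⧸ factorCentralizer M (B.subgroupOf H), inferInstance, inferInstance,
      QuotientGroup.map _ _ H.subtype hker, ⟨NormalFactor M (B.subgroupOf H), inferInstance,
        inferInstance, factorAction M (B.subgroupOf H), v, hp.of_injective ι hι,
        hH.central M _ hM hMab, ?_⟩, fun g hg => ⟨((⟨g, hg⟩ : H) : H ⧸ _), rfl⟩⟩
    intro d hd
    induction d using QuotientGroup.induction_on with
    | H g =>
      refine (QuotientGroup.eq_one_iff g).mpr ?_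
      have h1 := hfix g v hv hd
      refine MulEquiv.ext fun n => hι ?_
      rw [hequiv, h1]
      rfl

/-- A nonabelian chief factor of `G` contains a simple nonabelian normal subgroup invariant under
a given normal `ca`-`F`-subgroup acting nontrivially. -/
theorem IsChiefFactor.exists_simple_invariant (h : IsChiefFactor A B)
    (hnab : ¬ IsAbelianFactor A B) (H : Subgroup G) [H.Normal] (hH : IsCaGroup F H)
    (hHc : ¬ ∀ g ∈ H, factorConj A B g = 1) :
    ∃ (W : Subgroup (NormalFactor A B)) (_ : W.Normal), IsSimpleGroup W ∧
      (¬ ∀ x y : W, x * y = y * x) ∧ ∀ g ∈ H, ∀ n ∈ W, factorConj A B g n ∈ W := by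
  obtain ⟨M, hMn, ι, hM, hι, hequiv, hιn⟩ := h.exists_embedding H hHc
  have hM0 := hM.nontrivial
  have hne : ι.range ≠ ⊥ := by
    obtain ⟨n, hn⟩ := exists_ne (1 : NormalFactor M (B.subgroupOf H))
    exact fun h' => (map_ne_one_iff ι hι).mpr hn
      ((Subgroup.eq_bot_iff_forall _).mp h' _ ⟨n, rfl⟩)
  have hWc : ¬ ∀ x y : ι.range, x * y = y * x := fun hc =>
    hnab (h.isIrreducibleAction.comm_of_normal_comm hne hc)
  have hMab : ¬ IsAbelianFactor M (B.subgroupOf H) := by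
    intro hab
    refine hWc ?_
    rintro ⟨_, x, rfl⟩ ⟨_, y, rfl⟩
    refine Subtype.ext ?_
    change ι x * ι y = ι y * ι x
    rw [← map_mul, hab, map_mul]
  have hs := hH.simple M _ hM hMab
  refine ⟨ι.range, hιn, (MonoidHom.ofInjective hι).symm.isSimpleGroup, hWc, ?_⟩
  rintro g hg _ ⟨x, rfl⟩
  exact ⟨_, hequiv ⟨g, hg⟩ x⟩

theorem IsChiefFactor.isSimpleGroup (h : IsChiefFactor A B) (hnab : ¬ IsAbelianFactor A B)
    {H K : Subgroup G} [H.Normal] [K.Normal] (hHK : ∀ g, ∃ h ∈ H, ∃ k ∈ K, h * k = g)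
    (hH : IsCaGroup F H) (hK : IsCaGroup F K) : IsSimpleGroup (NormalFactor A B) := by
  have key : ∀ {W : Subgroup (NormalFactor A B)}, IsSimpleGroup W →
      (∀ g ∈ H, ∀ n ∈ W, factorConj A B g n ∈ W) → (∀ g ∈ K, ∀ n ∈ W, factorConj A B g n ∈ W) →
      IsSimpleGroup (NormalFactor A B) := by
    intro W hW h1 h2
    have hWtop : W = ⊤ := by
      refine (h.isIrreducibleAction W fun g n hn => ?_).resolve_left
        ((Subgroup.nontrivial_iff_ne_bot W).mp hW.toNontrivial)
      obtain ⟨x, hx, y, hy, rfl⟩ := hHK g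
      rw [map_mul, MulAut.mul_apply]
      exact h1 x hx _ (h2 y hy n hn)
    subst hWtop
    exact Subgroup.topEquiv.symm.isSimpleGroup
  by_cases hHc : ∀ g ∈ H, factorConj A B g = 1
  · by_cases hKc : ∀ g ∈ K, factorConj A B g = 1
    -- If `H` and `K` both act trivially then so does `A`, by conjugation on `A / B`, which is then
    -- abelian.
    · refine absurd (fun x y => ?_) hnab
      induction x using QuotientGroup.induction_on with
      | H a =>
        obtain ⟨g, hg, k, hk, hgk⟩ := hHK a
        have h1 : factorConj A B (a : G) = 1 := by rw [← hgk, map_mul, hHc g hg, hKc k hk, one_mul]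
        have h2 := factorConj_coe_apply a y
        rw [h1, MulAut.one_apply] at h2
        exact (eq_mul_inv_iff_mul_eq.mp h2).symm
    · obtain ⟨W, _, hW, -, hWK⟩ := h.exists_simple_invariant hnab K hK hKc
      exact key hW (fun g hg n hn => by rw [hHc g hg]; exact hn) hWK
  · obtain ⟨W, _, hW, hWc, hWH⟩ := h.exists_simple_invariant hnab H hH hHc
    by_cases hKc : ∀ g ∈ K, factorConj A B g = 1
    · exact key hW hWH (fun g hg n hn => by rw [hKc g hg]; exact hn)
    · obtain ⟨W', _, hW', -, hWK⟩ := h.exists_simple_invariant hnab K hK hKc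
      exact h.isIrreducibleAction.isSimpleGroup hHK hW hWc hW' hWH hWK

theorem IsChiefFactor.isFCentral (hF : IsSaturatedFormation F)
    (hU : ∀ (X : Type u) [Group X] [Finite X], IsSupersoluble X → F X) (h : IsChiefFactor A B)
    (hab : IsAbelianFactor A B) (hG : IsQuasinilpotent (commutator G))
    {H K : Subgroup G} [H.Normal] [K.Normal] (hHK : ∀ g, ∃ h ∈ H, ∃ k ∈ K, h * k = g)
    (hH : IsCaGroup F H) (hK : IsCaGroup F K) : IsFCentral F A B := by
  have hcyc : ∀ (X : Type u) [Group X] [Finite X], IsCyclic X → F X := fun X _ _ hX =>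
    hU X (isSupersoluble_of_isCyclic X hX)
  have hcomm := h.factorConj_comm hab hG
  have hN := h.nontrivial
  obtain ⟨p, hp, hpow⟩ := h.isIrreducibleAction.exists_prime_pow_eq_one hab
  have := Fact.mk hp
  have hNp : IsPGroup p (NormalFactor A B) := fun n => ⟨1, by rw [pow_one, hpow]⟩
  have hF1 : F PUnit.{u + 1} := hcyc _ inferInstance
  obtain ⟨D₁, _, _, j₁, hD₁, hj₁⟩ :=
    h.exists_hasRegularExtension hF.toIsFormation hF1 hab hcomm hNp H hH
  obtain ⟨D₂, _, _, j₂, hD₂, hj₂⟩ :=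
    h.exists_hasRegularExtension hF.toIsFormation hF1 hab hcomm hNp K hK
  have hQ : ∀ x y : G ⧸ factorCentralizer A B, x * y = y * x := by
    intro x y
    induction x using QuotientGroup.induction_on with
    | H g₁ =>
      induction y using QuotientGroup.induction_on with
      | H g₂ =>
        rw [← QuotientGroup.mk_mul, ← QuotientGroup.mk_mul]
        refine QuotientGroup.eq.mpr (MonoidHom.mem_ker.mpr ?_)
        rw [map_mul, map_inv, map_mul, map_mul, hcomm g₁ g₂, inv_mul_cancel]
  -- `j` may fail to be injective; only surjectivity matters, as irreducibility pulls back along `j`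
  -- and `F` is closed under quotients.
  let j : D₁ × D₂ →* G ⧸ factorCentralizer A B :=
    MonoidHom.noncommCoprod j₁ j₂ fun x y => hQ _ _
  have hj : Function.Surjective j := by
    intro q
    induction q using QuotientGroup.induction_on with
    | H g =>
      obtain ⟨x, hx, y, hy, rfl⟩ := hHK g
      obtain ⟨d₁, h1⟩ := hj₁ x hx
      obtain ⟨d₂, h2⟩ := hj₂ y hy
      refine ⟨(d₁, d₂), ?_⟩
      change j₁ d₁ * j₂ d₂ = _
      rw [h1, h2]
      rfl
  let _ : CommGroup (NormalFactor A B) :=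
    { (inferInstance : Group (NormalFactor A B)) with mul_comm := hab }
  have hFN : F (NormalFactor A B) :=
    hF.toIsFormation.of_commGroup hcyc (NormalFactor A B)
  have hFD := (hD₁.prod hF.toIsFormation hD₂).semidirectProduct hF hFN hNp
    ((factorAction A B).comp j) fun W hW => h.isIrreducibleAction W fun g n hn => by
      obtain ⟨d, hd⟩ := hj (g : G ⧸ factorCentralizer A B)
      have h1 := hW d n hn
      rw [MonoidHom.comp_apply, hd] at h1
      exact h1
  refine hF.toIsFormation.of_surjective (SemidirectProduct.map (MonoidHom.id _) j fun _ => rfl)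
    ?_ hFD
  rintro ⟨n, q⟩
  obtain ⟨d, rfl⟩ := hj q
  exact ⟨⟨n, d⟩, rfl⟩

end Products

theorem corollary4 (F : GroupClass.{u}) (hF : IsSaturatedFormation F)
    (hU : ∀ (X : Type u) [Group X] [Finite X], IsSupersoluble X → F X)
    (G : Type u) [Group G] [Finite G] (H K : Subgroup G) [H.Normal] [K.Normal]
    (hHK : (H : Set G) * (K : Set G) = Set.univ)
    (hH : IsCaGroup F H) (hK : IsCaGroup F K)
    (hG : IsQuasinilpotent (commutator G)) :
    IsCaGroup F G := by
  have hHK' : ∀ g, ∃ h ∈ H, ∃ k ∈ K, h * k = g := fun g =>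
    Set.mem_mul.mp (hHK.ge (Set.mem_univ g))
  exact ⟨fun A B _ _ h hnab => h.isSimpleGroup hnab hHK' hH hK,
    fun A B _ _ h hab => h.isFCentral hF hU hab hG hHK' hH hK⟩
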